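/- Let $(g_n(k))$ and $(h_n(k))$ $(n\ge 1,\ 1\le k\le 2n-1)$ be the triangles of rational numbers that are the unique solutions of the finite difference system $$f_n(k+2)-2f_n(k+1)+f_n(k)+4f_{n-1}(k)=0\qquad(n\ge 2,\ 1\le k\le 2n-3)$$ with the following initial values, where $\sum_k f_{n-1}(k)$ runs over $1\le k\le 2n-3$: - for $f=g$ (the tangent triangle): $g_1(1)=1$, and $g_n(1)=0$, $g_n(2)=2\sum_k g_{n-1}(k)$ for $n\ge 2$; - for $f=h$ (the secant triangle): $h_1(1)=1$, and $h_n(1)=\sum_k h_{n-1}(k)$, $h_n(2)=3\sum_k h_{n-1}(k)$ for $n\ge 2$. For such a triangle $f$ define the formal power series $$Z(x,y)=1+\sum_{n\ge 1}\ \sum_{1\le k\le 2n+1} f_{n+1}(k)\,\frac{x^{2n+1-k}}{(2n+1-k)!}\,\frac{y^{k-1}}{(k-1)!}\in\mathbb{Q}[[x,y]],$$ and write $Z^{\tan}$ and $Z^{\sec}$ for it when $f=g$ and $f=h$, respectively. Then, as formal power series, $$Z^{\tan}(x,y)=\sec(x+y)\cos(x-y),\qquad Z^{\sec}(x,y)=\sec^2(x+y)\cos(x-y).$$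 -/

import Mathlib

/-- The finite difference equation system `Δ² f_n(k) + 4 f_{n-1}(k) = 0` for `n ≥ 2` and
`1 ≤ k ≤ 2n - 3`. The triangle is `f_n(k) = f n k` with `n ≥ 1`, `1 ≤ k ≤ 2n - 1`; the values of `f`
at other indices play no role. -/
def IsDifferenceSolution (f : ℕ → ℕ → ℚ) : Prop :=
  ∀ n k : ℕ, 2 ≤ n → 1 ≤ k → k ≤ 2 * n - 3 →
    (f n (k + 2) - 2 * f n (k + 1) + f n k) + 4 * f (n - 1) k = 0

/-- The sum `∑_k f_n(k)` of the `n`-th row, over `1 ≤ k ≤ 2n - 1`. -/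
def rowSum (f : ℕ → ℕ → ℚ) (n : ℕ) : ℚ :=
  ∑ k ∈ Finset.Icc 1 (2 * n - 1), f n k

/-- `f` is the tangent triangle: the solution of the system with `f_1(1) = 1`, and `f_n(1) = 0`,
`f_n(2) = 2 ∑_k f_{n-1}(k)` for `n ≥ 2`. -/
structure IsTangentTriangle (f : ℕ → ℕ → ℚ) : Prop where
  difference : IsDifferenceSolution f
  apex : f 1 1 = 1
  first : ∀ n : ℕ, 2 ≤ n → f n 1 = 0
  second : ∀ n : ℕ, 2 ≤ n → f n 2 = 2 * rowSum f (n - 1)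

/-- `f` is the secant triangle: the solution of the system with `f_1(1) = 1`, and
`f_n(1) = ∑_k f_{n-1}(k)`, `f_n(2) = 3 ∑_k f_{n-1}(k)` for `n ≥ 2`. -/
structure IsSecantTriangle (f : ℕ → ℕ → ℚ) : Prop where
  difference : IsDifferenceSolution f
  apex : f 1 1 = 1
  first : ∀ n : ℕ, 2 ≤ n → f n 1 = rowSum f (n - 1)
  second : ∀ n : ℕ, 2 ≤ n → f n 2 = 3 * rowSum f (n - 1)

/-- The row determined by the previous row `p` and by its first two entries `a`, `b`. -/
def nextRow (p : ℕ → ℚ) (a b : ℚ) : ℕ → ℚ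
  | 0 => 0
  | 1 => a
  | 2 => b
  | k + 3 => 2 * nextRow p a b (k + 2) - nextRow p a b (k + 1) - 4 * p (k + 1)

/-- The triangle whose `n`-th row starts with `c S`, `d S` for `n ≥ 2`, where `S` is the sum of
the row above. -/
def buildTriangle (c d : ℚ) : ℕ → ℕ → ℚ
  | 0 => fun _ => 0
  | 1 => fun _ => 1
  | n + 2 =>
    let p := buildTriangle c d (n + 1)
    let S := ∑ k ∈ Finset.Icc 1 (2 * (n + 1) - 1), p k
    nextRow p (c * S) (d * S)

theorem isDifferenceSolution_buildTriangle (c d : ℚ) :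
    IsDifferenceSolution (buildTriangle c d) := by
  intro n k hn hk _
  obtain ⟨n, rfl⟩ : ∃ m, n = m + 2 := ⟨n - 2, by omega⟩
  obtain ⟨k, rfl⟩ : ∃ m, k = m + 1 := ⟨k - 1, by omega⟩
  simp only [buildTriangle, show n + 2 - 1 = n + 1 from rfl]
  rw [show k + 1 + 2 = k + 3 from rfl, nextRow]
  ring

/-- The tangent triangle exists. -/
theorem exists_isTangentTriangle : ∃ f, IsTangentTriangle f := by
  refine ⟨buildTriangle 0 2, isDifferenceSolution_buildTriangle 0 2, rfl, ?_, ?_⟩ <;>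
  · intro n hn
    obtain ⟨n, rfl⟩ : ∃ m, n = m + 2 := ⟨n - 2, by omega⟩
    simp [buildTriangle, nextRow, rowSum]

/-- The secant triangle exists. -/
theorem exists_isSecantTriangle : ∃ f, IsSecantTriangle f := by
  refine ⟨buildTriangle 1 3, isDifferenceSolution_buildTriangle 1 3, rfl, ?_, ?_⟩ <;>
  · intro n hn
    obtain ⟨n, rfl⟩ : ∃ m, n = m + 2 := ⟨n - 2, by omega⟩
    simp [buildTriangle, nextRow, rowSum]

/-- The double sum
`∑_{n ≥ 1} ∑_{1 ≤ k ≤ 2n+1} f_{n+1}(k) x^{2n+1-k}/(2n+1-k)! y^{k-1}/(k-1)!`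
as a formal power series in `x = X 0` and `y = X 1`, given by its coefficients: the pair `(n, k)`
contributes to the monomial `x^i y^j` exactly when `i + j = 2n` and `j = k - 1`. -/
noncomputable def genSum (f : ℕ → ℕ → ℚ) : MvPowerSeries (Fin 2) ℚ := fun d =>
  if Even (d 0 + d 1) ∧ 1 ≤ (d 0 + d 1) / 2 then
    f ((d 0 + d 1) / 2 + 1) (d 1 + 1) / ((d 0).factorial * (d 1).factorial)
  else 0

/-- The generating function `Z(x,y) = 1 + ∑_{n ≥ 1} ∑_{1 ≤ k ≤ 2n+1} …` of a triangle. -/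
noncomputable def genFun (f : ℕ → ℕ → ℚ) : MvPowerSeries (Fin 2) ℚ := 1 + genSum f

/-- The power series of `sec = 1 / cos`. -/
noncomputable def secSeries : PowerSeries ℚ := (PowerSeries.cos ℚ)⁻¹

/-!
The two series are the cases `m = 0` and `m = 1` of `Z = sec^{m+1}(x + y) cos(x - y)`. The
derivation `D = ∂/∂x - ∂/∂y` kills `x + y` and sends `x - y` to `2`, so `D² Z = -4 Z`; on
exponential coefficients this is exactly the difference system. As `Z` is symmetric in `x` and `y`,
summing the second differences over row `n` gives `2 S = f_n(2) - f_n(1)`, where `S` is the sum of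
row `n - 1`.
Finally `Z = sec^m` and `-D Z = 2 sec^{m+1} sin` on the line `y = 0`, and
`(sec^m)' = m sec^{m+1} sin`, whence `2 f_n(1) = m (f_n(2) - f_n(1))`. Together these say
`f_n(1) = m S` and `f_n(2) = (m + 2) S`, and the system with these initial values has only one
solution.
-/

open PowerSeries

section Substitution

variable {R σ τ : Type*} [CommRing R]

theorem eq_zero_of_forall_pow_dvd {f g : MvPowerSeries σ R}
    (hg : MvPowerSeries.constantCoeff g = 0) (hf : ∀ n : ℕ, g ^ n ∣ f) : f = 0 := by
  ext e
  obtain ⟨q, rfl⟩ := hf (e.degree + 1)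
  refine MvPowerSeries.coeff_of_lt_order ?_
  calc (e.degree : ℕ∞) < (e.degree + 1 : ℕ) := by exact_mod_cast Nat.lt_succ_self _
    _ ≤ (g ^ (e.degree + 1)).order := MvPowerSeries.le_order_pow_of_constantCoeff_eq_zero _ hg
    _ ≤ (g ^ (e.degree + 1) * q).order := le_self_add.trans MvPowerSeries.le_order_mul

theorem derivation_subst (D : Derivation R (MvPowerSeries σ R) (MvPowerSeries σ R))
    {g : MvPowerSeries σ R} (hg : MvPowerSeries.constantCoeff g = 0) (A : PowerSeries R) :
    D (A.subst g) = (d⁄dX R A).subst g * D g := by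
  -- Writing `A = X B + A(0)`, the defect of `A` is `g` times that of `B`.
  rw [← sub_eq_zero]
  refine eq_zero_of_forall_pow_dvd hg fun n => ?_
  induction n generalizing A with
  | zero => simp
  | succ n ih =>
    have hs : HasSubst g := .of_constantCoeff_zero hg
    obtain ⟨B, a, rfl⟩ : ∃ B a, A = X * B + C a := ⟨_, _, A.eq_X_mul_shift_add_const⟩
    have defect : D ((X * B + C a).subst g) - (d⁄dX R (X * B + C a)).subst g * D g =
        g * (D (B.subst g) - (d⁄dX R B).subst g * D g) := by
      simp only [map_add, derivative_C, add_zero, Derivation.leibniz, derivative_X, smul_eq_mul,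
        mul_one, subst_add hs, subst_mul hs, subst_X hs, subst_C]
      rw [show D (MvPowerSeries.C a) = 0 from D.map_algebraMap a]
      ring
    rw [defect, pow_succ']
    exact mul_dvd_mul_left g (ih B)

theorem rescale_subst (r : σ → R) {g : MvPowerSeries σ R} (hg : HasSubst g) (A : PowerSeries R) :
    MvPowerSeries.rescale r (A.subst g) = A.subst (MvPowerSeries.rescale r g) := by
  simp only [MvPowerSeries.rescale_eq_subst, subst_def]
  exact MvPowerSeries.subst_comp_subst_apply hg.const (.smul_X r) A

theorem rescale_X_eq_smul (r : σ → R) (i : σ) :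
    MvPowerSeries.rescale r (MvPowerSeries.X i) = r i • MvPowerSeries.X i := by
  rw [MvPowerSeries.rescale_eq_subst, MvPowerSeries.subst_X (.smul_X r), Pi.smul_apply']

theorem rename_subst (f : σ → τ) [Filter.TendstoCofinite f] {g : MvPowerSeries σ R}
    (hg : HasSubst g) (A : PowerSeries R) :
    MvPowerSeries.rename f (A.subst g) = A.subst (MvPowerSeries.rename f g) := by
  simp only [MvPowerSeries.rename_eq_subst, subst_def]
  exact MvPowerSeries.subst_comp_subst_apply hg.const (.X_comp f) A

theorem subst_rescale (r : R) {g : MvPowerSeries σ R} (hg : HasSubst g) (A : PowerSeries R) :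
    (rescale r A).subst g = A.subst (r • g) := by
  rw [rescale_eq_subst, subst_comp_subst_apply (.smul_X' r) hg, subst_smul hg, subst_X hg]

end Substitution

section Trigonometric

variable (R : Type*) [CommRing R] [Algebra ℚ R]

theorem constantCoeff_cos : constantCoeff (cos R) = 1 := by
  simp [← coeff_zero_eq_constantCoeff_apply, cos]

theorem algebraMap_div_factorial_succ_mul (q : ℚ) (n : ℕ) :
    algebraMap ℚ R (q / (n + 1).factorial) * (n + 1) = algebraMap ℚ R (q / n.factorial) := by
  rw [← map_natCast (algebraMap ℚ R) n, ← map_one (algebraMap ℚ R), ← map_add, ← map_mul,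
    Nat.factorial_succ]
  congr 1
  push_cast
  field_simp

theorem derivative_sin : d⁄dX R (sin R) = cos R := by
  ext n
  rw [coeff_derivative, sin, cos, coeff_mk, coeff_mk]
  rcases n.even_or_odd with hn | hn
  · rw [if_neg (Nat.not_even_iff_odd.mpr hn.add_one), if_pos hn, algebraMap_div_factorial_succ_mul,
      Nat.succ_div_of_not_dvd (by grind)]
  · rw [if_pos hn.add_one, if_neg (Nat.not_even_iff_odd.mpr hn), zero_mul]

theorem derivative_cos : d⁄dX R (cos R) = -sin R := by
  ext n
  rw [coeff_derivative, map_neg, sin, cos, coeff_mk, coeff_mk]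
  rcases n.even_or_odd with hn | hn
  · rw [if_neg (Nat.not_even_iff_odd.mpr hn.add_one), if_pos hn, zero_mul, neg_zero]
  · rw [if_pos hn.add_one, if_neg (Nat.not_even_iff_odd.mpr hn), algebraMap_div_factorial_succ_mul,
      Nat.succ_div_of_dvd (even_iff_two_dvd.mp hn.add_one), pow_succ, mul_neg_one, neg_div, map_neg]

theorem rescale_neg_one_cos : rescale (-1) (cos R) = cos R := by
  ext n
  rcases n.even_or_odd with hn | hn
  · simp [hn.neg_one_pow]
  · simp [cos, Nat.not_even_iff_odd.mpr hn]

end Trigonometric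

theorem secSeries_mul_cos : secSeries * cos ℚ = 1 :=
  PowerSeries.inv_mul_cancel _ (by simp [constantCoeff_cos])

theorem constantCoeff_secSeries : constantCoeff secSeries = 1 := by
  simp [secSeries, constantCoeff_cos]

theorem rescale_neg_one_secSeries : rescale (-1) secSeries = secSeries := by
  rw [secSeries, eq_inv_iff_mul_eq_one (by simp [constantCoeff_cos])]
  nth_rw 2 [← rescale_neg_one_cos]
  rw [← map_mul, ← secSeries, secSeries_mul_cos, map_one]

theorem derivative_secSeries_pow (m : ℕ) :
    d⁄dX ℚ (secSeries ^ m) = m * (secSeries ^ (m + 1) * sin ℚ) := by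
  rw [derivative_pow, secSeries, derivative_inv', derivative_cos]
  rcases m with _ | m
  · simp
  · rw [Nat.add_sub_cancel]
    ring

section AddSub

variable {R : Type*} [CommRing R]

theorem hasSubst_X_add_X :
    HasSubst (MvPowerSeries.X 0 + MvPowerSeries.X 1 : MvPowerSeries (Fin 2) R) :=
  .of_constantCoeff_zero (by simp)

theorem hasSubst_X_sub_X :
    HasSubst (MvPowerSeries.X 0 - MvPowerSeries.X 1 : MvPowerSeries (Fin 2) R) :=
  .of_constantCoeff_zero (by simp)

/-- The product `A(x + y) B(x - y)`, with `x = X 0` and `y = X 1`. -/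
noncomputable def addSubProd (A B : PowerSeries R) : MvPowerSeries (Fin 2) R :=
  A.subst (MvPowerSeries.X 0 + MvPowerSeries.X 1 : MvPowerSeries (Fin 2) R) *
    B.subst (MvPowerSeries.X 0 - MvPowerSeries.X 1 : MvPowerSeries (Fin 2) R)

theorem addSubProd_neg (A B : PowerSeries R) : addSubProd A (-B) = -addSubProd A B := by
  simp only [addSubProd, ← coe_substAlgHom hasSubst_X_sub_X, map_neg, mul_neg]

variable (R) in
/-- The derivation `∂/∂x - ∂/∂y`, which sees `x + y` as a constant. -/
noncomputable def pderivSub : Derivation R (MvPowerSeries (Fin 2) R) (MvPowerSeries (Fin 2) R) :=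
  MvPowerSeries.pderiv R 0 - MvPowerSeries.pderiv R 1

theorem pderivSub_addSubProd (A B : PowerSeries R) :
    pderivSub R (addSubProd A B) = 2 • addSubProd A (d⁄dX R B) := by
  have hX : pderivSub R (MvPowerSeries.X 0) = 1 := by simp [pderivSub]
  have hY : pderivSub R (MvPowerSeries.X 1) = -1 := by simp [pderivSub]
  rw [addSubProd, Derivation.leibniz, derivation_subst _ (by simp), derivation_subst _ (by simp),
    map_add, map_sub, hX, hY, addSubProd]
  simp only [smul_eq_mul, nsmul_eq_mul]
  push_cast
  ring

theorem rename_swap_addSubProd (A B : PowerSeries R) :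
    MvPowerSeries.rename (Equiv.swap 0 1).toEmbedding (addSubProd A B) =
      addSubProd A (rescale (-1) B) := by
  rw [addSubProd, map_mul, rename_subst _ hasSubst_X_add_X, rename_subst _ hasSubst_X_sub_X,
    addSubProd, subst_rescale _ hasSubst_X_sub_X]
  simp [add_comm]

theorem rescale_const_addSubProd (r : R) (A B : PowerSeries R) :
    MvPowerSeries.rescale (fun _ => r) (addSubProd A B) =
      addSubProd (rescale r A) (rescale r B) := by
  rw [addSubProd, map_mul, rescale_subst _ hasSubst_X_add_X, rescale_subst _ hasSubst_X_sub_X,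
    addSubProd, subst_rescale _ hasSubst_X_add_X, subst_rescale _ hasSubst_X_sub_X]
  simp only [map_add, map_sub, rescale_X_eq_smul, smul_add, smul_sub]

theorem rescale_one_zero_addSubProd (A B : PowerSeries R) :
    MvPowerSeries.rescale ![1, 0] (addSubProd A B) =
      (A * B).subst (MvPowerSeries.X 0 : MvPowerSeries (Fin 2) R) := by
  rw [addSubProd, map_mul, rescale_subst _ hasSubst_X_add_X, rescale_subst _ hasSubst_X_sub_X,
    subst_mul (.X 0)]
  simp [rescale_X_eq_smul]

theorem coeff_single_zero_addSubProd (A B : PowerSeries R) (n : ℕ) :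
    MvPowerSeries.coeff (Finsupp.single 0 n) (addSubProd A B) = coeff n (A * B) := by
  have h := congrArg (MvPowerSeries.coeff (Finsupp.single 0 n)) (rescale_one_zero_addSubProd A B)
  simpa [MvPowerSeries.coeff_rescale, coeff_subst_single] using h

/-- The exponential coefficient of a bivariate series, i.e. that of `x^i / i! * y^j / j!`. -/
noncomputable def expCoeff (i j : ℕ) : MvPowerSeries (Fin 2) R →ₗ[R] R :=
  ((i.factorial * j.factorial : ℕ) : R) •
    MvPowerSeries.coeff (Finsupp.single 0 i + Finsupp.single 1 j)

theorem expCoeff_pderivSub (i j : ℕ) (F : MvPowerSeries (Fin 2) R) :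
    expCoeff i j (pderivSub R F) = expCoeff (i + 1) j F - expCoeff i (j + 1) F := by
  simp only [expCoeff, pderivSub, Derivation.sub_apply, LinearMap.smul_apply, map_sub,
    MvPowerSeries.coeff_pderiv, Finsupp.single_add, add_right_comm, add_assoc, Finsupp.add_apply,
    Finsupp.single_eq_same, Finsupp.single_eq_of_ne, ne_eq, zero_ne_one, one_ne_zero,
    not_false_eq_true, add_zero, zero_add, smul_eq_mul, Nat.factorial_succ]
  push_cast
  ring

theorem expCoeff_rename_swap (i j : ℕ) (F : MvPowerSeries (Fin 2) R) :
    expCoeff i j (MvPowerSeries.rename (Equiv.swap 0 1).toEmbedding F) = expCoeff j i F := by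
  have hij : (Finsupp.single 0 i + Finsupp.single 1 j : Fin 2 →₀ ℕ) =
      (Finsupp.single 0 j + Finsupp.single 1 i : Fin 2 →₀ ℕ).embDomain
        (Equiv.swap 0 1).toEmbedding := by
    simp [Finsupp.embDomain_add, Finsupp.embDomain_single, add_comm]
  simp only [expCoeff, LinearMap.smul_apply, hij, MvPowerSeries.coeff_embDomain_rename, mul_comm]

theorem expCoeff_addSubProd_zero (A B : PowerSeries R) (n : ℕ) :
    expCoeff n 0 (addSubProd A B) = n.factorial * coeff n (A * B) := by
  simp [expCoeff, coeff_single_zero_addSubProd]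

end AddSub

section CosSub

variable {R : Type*} [CommRing R] [Algebra ℚ R]

theorem pderivSub_pderivSub_addSubProd_cos (A : PowerSeries R) :
    pderivSub R (pderivSub R (addSubProd A (cos R))) = -(4 • addSubProd A (cos R)) := by
  rw [pderivSub_addSubProd, map_nsmul, pderivSub_addSubProd, derivative_cos, map_neg,
    derivative_sin, addSubProd_neg, smul_neg, smul_neg, smul_smul]
  norm_num

theorem expCoeff_addSubProd_cos_recurrence (A : PowerSeries R) (i j : ℕ) :
    expCoeff i (j + 2) (addSubProd A (cos R)) -
      2 * expCoeff (i + 1) (j + 1) (addSubProd A (cos R)) +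
      expCoeff (i + 2) j (addSubProd A (cos R)) + 4 * expCoeff i j (addSubProd A (cos R)) = 0 := by
  have h := congrArg (expCoeff i j) (pderivSub_pderivSub_addSubProd_cos A)
  rw [expCoeff_pderivSub, expCoeff_pderivSub, expCoeff_pderivSub, map_neg, map_nsmul,
    nsmul_eq_mul, Nat.cast_ofNat] at h
  linear_combination h

theorem expCoeff_addSubProd_cos_comm (A : PowerSeries R) (i j : ℕ) :
    expCoeff i j (addSubProd A (cos R)) = expCoeff j i (addSubProd A (cos R)) := by
  rw [← expCoeff_rename_swap, rename_swap_addSubProd, rescale_neg_one_cos]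

end CosSub

/-- The triangle of exponential coefficients of `Z`: row `n` holds those of total degree `2n - 2`,
in increasing order of the exponent `k - 1` of `y`. -/
noncomputable def triangleOf (Z : MvPowerSeries (Fin 2) ℚ) (n k : ℕ) : ℚ :=
  expCoeff (2 * n - 1 - k) (k - 1) Z

theorem isDifferenceSolution_triangleOf (A : PowerSeries ℚ) :
    IsDifferenceSolution (triangleOf (addSubProd A (cos ℚ))) := by
  intro n k hn hk hkn
  have h := expCoeff_addSubProd_cos_recurrence A (2 * n - 3 - k) (k - 1)
  rw [show k - 1 + 2 = k + 2 - 1 by omega, show k - 1 + 1 = k + 1 - 1 by omega,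
    show 2 * n - 3 - k + 2 = 2 * n - 1 - k by omega,
    show 2 * n - 3 - k + 1 = 2 * n - 1 - (k + 1) by omega] at h
  simpa only [triangleOf, show 2 * (n - 1) - 1 - k = 2 * n - 3 - k by omega,
    show 2 * n - 1 - (k + 2) = 2 * n - 3 - k by omega] using h

theorem triangleOf_reflect (A : PowerSeries ℚ) {n k : ℕ} (hk : 1 ≤ k) (hkn : k ≤ 2 * n - 1) :
    triangleOf (addSubProd A (cos ℚ)) n (2 * n - k) = triangleOf (addSubProd A (cos ℚ)) n k := by
  rw [triangleOf, expCoeff_addSubProd_cos_comm, triangleOf]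
  congr 2 <;> omega

theorem IsDifferenceSolution.four_mul_sum {f : ℕ → ℕ → ℚ} (hf : IsDifferenceSolution f) {n m : ℕ}
    (hm : m ≤ 2 * n - 3) :
    4 * ∑ k ∈ Finset.Icc 1 m, f (n - 1) k = f n 2 - f n 1 - (f n (m + 2) - f n (m + 1)) := by
  induction m with
  | zero => simp
  | succ m ih =>
    rw [Finset.sum_Icc_succ_top (by omega)]
    linear_combination ih (by omega) + hf n (m + 1) (by omega) (by omega) hm

theorem two_mul_rowSum_triangleOf (A : PowerSeries ℚ) {n : ℕ} (hn : 2 ≤ n) :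
    2 * rowSum (triangleOf (addSubProd A (cos ℚ))) (n - 1) =
      triangleOf (addSubProd A (cos ℚ)) n 2 - triangleOf (addSubProd A (cos ℚ)) n 1 := by
  have h := (isDifferenceSolution_triangleOf A).four_mul_sum (n := n) le_rfl
  rw [show 2 * n - 3 + 2 = 2 * n - 1 by omega, show 2 * n - 3 + 1 = 2 * n - 2 by omega,
    triangleOf_reflect A le_rfl (by omega), triangleOf_reflect A one_le_two (by omega)] at h
  rw [rowSum, show 2 * (n - 1) - 1 = 2 * n - 3 by omega]
  linear_combination h / 2

/-- The common generalization of the tangent triangle (`m = 0`) and of the secant triangle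
(`m = 1`): row `n` starts with `m S` and `(m + 2) S`, where `S` is the sum of row `n - 1`. -/
structure IsSecPowTriangle (m : ℕ) (f : ℕ → ℕ → ℚ) : Prop where
  difference : IsDifferenceSolution f
  apex : f 1 1 = 1
  first : ∀ n : ℕ, 2 ≤ n → f n 1 = m * rowSum f (n - 1)
  second : ∀ n : ℕ, 2 ≤ n → f n 2 = (m + 2) * rowSum f (n - 1)

theorem IsTangentTriangle.isSecPowTriangle {f : ℕ → ℕ → ℚ} (hf : IsTangentTriangle f) :
    IsSecPowTriangle 0 f where
  difference := hf.difference
  apex := hf.apex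
  first n hn := by simpa using hf.first n hn
  second n hn := by simpa using hf.second n hn

theorem IsSecantTriangle.isSecPowTriangle {f : ℕ → ℕ → ℚ} (hf : IsSecantTriangle f) :
    IsSecPowTriangle 1 f where
  difference := hf.difference
  apex := hf.apex
  first n hn := by simpa using hf.first n hn
  second n hn := by rw [hf.second n hn]; norm_num

theorem IsDifferenceSolution.eqOn_row {f f' : ℕ → ℕ → ℚ} (hf : IsDifferenceSolution f)
    (hf' : IsDifferenceSolution f') {n : ℕ}
    (prev : Set.EqOn (f (n - 1)) (f' (n - 1)) (Set.Icc 1 (2 * (n - 1) - 1)))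
    (first : f n 1 = f' n 1) (second : f n 2 = f' n 2) :
    Set.EqOn (f n) (f' n) (Set.Icc 1 (2 * n - 1)) := by
  rintro k ⟨hk, hkn⟩
  induction k using Nat.strong_induction_on with
  | _ k ih =>
    match k, hk with
    | 1, _ => exact first
    | 2, _ => exact second
    | k + 3, _ =>
      linear_combination hf n (k + 1) (by omega) (by omega) (by omega) -
        hf' n (k + 1) (by omega) (by omega) (by omega) -
        4 * prev (x := k + 1) ⟨by omega, by omega⟩ -
        ih (k + 1) (by omega) (by omega) (by omega) +
        2 * ih (k + 2) (by omega) (by omega) (by omega)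

theorem IsSecPowTriangle.eqOn {m : ℕ} {f f' : ℕ → ℕ → ℚ} (hf : IsSecPowTriangle m f)
    (hf' : IsSecPowTriangle m f') (n : ℕ) : Set.EqOn (f n) (f' n) (Set.Icc 1 (2 * n - 1)) := by
  induction n with
  | zero => simp
  | succ n ih =>
    obtain rfl | hn := n.eq_zero_or_pos
    · simp [hf.apex, hf'.apex]
    · have hS : rowSum f n = rowSum f' n :=
        Finset.sum_congr rfl fun k hk => ih (Finset.mem_Icc.mp hk)
      refine hf.difference.eqOn_row hf'.difference ih ?_ ?_
      · rw [hf.first _ (by omega), hf'.first _ (by omega), Nat.add_sub_cancel, hS]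
      · rw [hf.second _ (by omega), hf'.second _ (by omega), Nat.add_sub_cancel, hS]

/-- The series `sec^{m+1}(x + y) cos(x - y)`. -/
noncomputable def secPowSeries (m : ℕ) : MvPowerSeries (Fin 2) ℚ :=
  addSubProd (secSeries ^ (m + 1)) (cos ℚ)

theorem secSeries_pow_succ_mul_cos (m : ℕ) : secSeries ^ (m + 1) * cos ℚ = secSeries ^ m := by
  rw [pow_succ, mul_assoc, secSeries_mul_cos, mul_one]

theorem constantCoeff_secPowSeries (m : ℕ) : MvPowerSeries.constantCoeff (secPowSeries m) = 1 := by
  have h := coeff_single_zero_addSubProd (secSeries ^ (m + 1)) (cos ℚ) 0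
  simpa [secPowSeries, secSeries_pow_succ_mul_cos, constantCoeff_secSeries] using h

theorem rescale_neg_one_secPowSeries (m : ℕ) :
    MvPowerSeries.rescale (fun _ => -1) (secPowSeries m) = secPowSeries m := by
  rw [secPowSeries, rescale_const_addSubProd, map_pow, rescale_neg_one_secSeries,
    rescale_neg_one_cos]

theorem expCoeff_succ_zero_secPowSeries (m i : ℕ) :
    2 * expCoeff (i + 1) 0 (secPowSeries m) =
      m * (expCoeff i 1 (secPowSeries m) - expCoeff (i + 1) 0 (secPowSeries m)) := by
  have first : expCoeff (i + 1) 0 (secPowSeries m) =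
      m * (i.factorial * coeff i (secSeries ^ (m + 1) * sin ℚ)) := by
    have h := congrArg (coeff i) (derivative_secSeries_pow m)
    rw [coeff_derivative, ← map_natCast (C (R := ℚ)), coeff_C_mul] at h
    rw [secPowSeries, expCoeff_addSubProd_zero, secSeries_pow_succ_mul_cos, Nat.factorial_succ]
    push_cast
    linear_combination i.factorial * h
  have slope : expCoeff (i + 1) 0 (secPowSeries m) - expCoeff i 1 (secPowSeries m) =
      -(2 * (i.factorial * coeff i (secSeries ^ (m + 1) * sin ℚ))) := by
    rw [← expCoeff_pderivSub, secPowSeries, pderivSub_addSubProd, derivative_cos, addSubProd_neg,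
      map_nsmul, map_neg, expCoeff_addSubProd_zero, nsmul_eq_mul, Nat.cast_ofNat, mul_neg]
  linear_combination 2 * first + m * slope

theorem isSecPowTriangle_triangleOf (m : ℕ) : IsSecPowTriangle m (triangleOf (secPowSeries m)) := by
  have sum {n : ℕ} (hn : 2 ≤ n) := two_mul_rowSum_triangleOf (secSeries ^ (m + 1)) hn
  have ratio {n : ℕ} (hn : 2 ≤ n) : 2 * triangleOf (secPowSeries m) n 1 =
      m * (triangleOf (secPowSeries m) n 2 - triangleOf (secPowSeries m) n 1) := by
    rw [triangleOf, triangleOf, show 2 * n - 1 - 1 = 2 * n - 1 - 2 + 1 by omega]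
    exact expCoeff_succ_zero_secPowSeries m _
  rw [← secPowSeries] at sum
  refine ⟨isDifferenceSolution_triangleOf _, ?_, fun n hn => ?_, fun n hn => ?_⟩
  · simp [triangleOf, expCoeff, constantCoeff_secPowSeries]
  · linear_combination ratio hn / 2 - m / 2 * sum hn
  · linear_combination ratio hn / 2 - (m + 2) / 2 * sum hn

theorem genFun_congr {f f' : ℕ → ℕ → ℚ}
    (h : ∀ n, Set.EqOn (f n) (f' n) (Set.Icc 1 (2 * n - 1))) : genFun f = genFun f' := by
  have hsum : genSum f = genSum f' := by
    funext d
    simp only [genSum]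
    split_ifs with hd
    · rw [h _ ⟨by omega, by grind⟩]
    · rfl
  rw [genFun, genFun, hsum]

theorem coeff_eq_triangleOf_div (Z : MvPowerSeries (Fin 2) ℚ) {d : Fin 2 →₀ ℕ}
    (hd : Even (d 0 + d 1)) :
    MvPowerSeries.coeff d Z = triangleOf Z ((d 0 + d 1) / 2 + 1) (d 1 + 1) /
      ((d 0).factorial * (d 1).factorial) := by
  have hd' : Finsupp.single 0 (d 0) + Finsupp.single 1 (d 1) = d := by
    ext i; fin_cases i <;> simp
  rw [triangleOf, show 2 * ((d 0 + d 1) / 2 + 1) - 1 - (d 1 + 1) = d 0 by grind,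
    Nat.add_sub_cancel, expCoeff, hd', LinearMap.smul_apply, smul_eq_mul, Nat.cast_mul,
    mul_div_cancel_left₀ _ (by positivity)]

theorem coeff_eq_zero_of_rescale_neg_one {Z : MvPowerSeries (Fin 2) ℚ}
    (hZ : MvPowerSeries.rescale (fun _ => -1) Z = Z) {d : Fin 2 →₀ ℕ} (hd : Odd (d 0 + d 1)) :
    MvPowerSeries.coeff d Z = 0 := by
  have h := congrArg (MvPowerSeries.coeff d) hZ
  rw [MvPowerSeries.coeff_rescale, Finsupp.prod_fintype _ _ fun _ => pow_zero _, Fin.prod_univ_two,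
    ← pow_add, hd.neg_one_pow] at h
  linarith

theorem genFun_triangleOf {Z : MvPowerSeries (Fin 2) ℚ} (h0 : MvPowerSeries.constantCoeff Z = 1)
    (hZ : MvPowerSeries.rescale (fun _ => -1) Z = Z) : genFun (triangleOf Z) = Z := by
  ext d
  rw [genFun, map_add, MvPowerSeries.coeff_one, MvPowerSeries.coeff_apply (genSum _), genSum]
  obtain rfl | hd := eq_or_ne d 0
  · simpa using h0.symm
  · have hpos : d 0 + d 1 ≠ 0 := fun h => hd (by ext i; fin_cases i <;> simp <;> omega)
    rw [if_neg hd, zero_add]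
    split_ifs with he
    · exact (coeff_eq_triangleOf_div Z he.1).symm
    · exact (coeff_eq_zero_of_rescale_neg_one hZ (by grind)).symm

theorem theorem1p2_general (m : ℕ) {f : ℕ → ℕ → ℚ} (hf : IsSecPowTriangle m f) :
    genFun f =
      secSeries.subst (MvPowerSeries.X 0 + MvPowerSeries.X 1 : MvPowerSeries (Fin 2) ℚ) ^ (m + 1) *
        (PowerSeries.cos ℚ).subst
          (MvPowerSeries.X 0 - MvPowerSeries.X 1 : MvPowerSeries (Fin 2) ℚ) := by
  calc genFun f = genFun (triangleOf (secPowSeries m)) :=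
        genFun_congr (hf.eqOn (isSecPowTriangle_triangleOf m))
    _ = secPowSeries m :=
        genFun_triangleOf (constantCoeff_secPowSeries m) (rescale_neg_one_secPowSeries m)
    _ = _ := by rw [secPowSeries, addSubProd, subst_pow hasSubst_X_add_X]

theorem theorem1p2 (g h : ℕ → ℕ → ℚ) (hg : IsTangentTriangle g) (hh : IsSecantTriangle h) :
    genFun g =
        secSeries.subst (MvPowerSeries.X 0 + MvPowerSeries.X 1 : MvPowerSeries (Fin 2) ℚ) *
          (PowerSeries.cos ℚ).subst
            (MvPowerSeries.X 0 - MvPowerSeries.X 1 : MvPowerSeries (Fin 2) ℚ) ∧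
      genFun h =
        secSeries.subst (MvPowerSeries.X 0 + MvPowerSeries.X 1 : MvPowerSeries (Fin 2) ℚ) ^ 2 *
          (PowerSeries.cos ℚ).subst
            (MvPowerSeries.X 0 - MvPowerSeries.X 1 : MvPowerSeries (Fin 2) ℚ) :=
  ⟨by simpa using theorem1p2_general 0 hg.isSecPowTriangle,
    theorem1p2_general 1 hh.isSecPowTriangle⟩
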